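/- Let the torus $\mathbb{T}^n = U(1)^n$ act on the complex manifold $(\mathbb{C}^*)^n$ by coordinatewise multiplication, and let $\omega$ be a (smooth) Kähler form on $(\mathbb{C}^*)^n$ such that this action is Hamiltonian, i.e. there is a $\mathbb{T}^n$-invariant moment map $\mu : (\mathbb{C}^*)^n \to (\mathbb{R}^n)^*$ with $d\langle \mu, X\rangle = \iota_{\tilde X}\omega$ for every $X \in \mathbb{R}^n = \mathrm{Lie}(\mathbb{T}^n)$, where $\tilde X_z = (i X_j z_j)_j$ is the fundamental vector field of $X$. Let $J$ denote multiplication by $i$, $g(u,v) = \omega(u, Jv)$ the Riemannian metric, $h = g - i\omega$ the Hermitian metric, $\mathrm{Ric}$ the Ricci tensor of $g$, and $H = \det\big(h(\tilde X_i, \tilde X_j)\big)_{i,j}$ for the standard basis $X_1,\dots,X_n$ of $\mathbb{R}^n$. Identify the orbit space $(\mathbb{C}^*)^n/\mathbb{T}^n$ with $\mathbb{R}^n$, where $x \in \mathbb{R}^n$ corresponds to the orbit of $(e^{x_1},\dots,e^{x_n})$, and let $\mathrm{Vol}(x)$ be the $n$-dimensional Riemannian volume, with respect to $g$, of this orbit.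 Then $H$ is $\mathbb{T}^n$-invariant, $\mathrm{Vol}$ is a well-defined positive function on the orbit space, and: 1. $\mathrm{Ric} \le 0$ on $(\mathbb{C}^*)^n$ if and only if $\log \mathrm{Vol}$ is convex on $\mathbb{R}^n$; in this case $\mathrm{Vol}$ is convex. 2. $\mathrm{Ric} \ge 0$ on $(\mathbb{C}^*)^n$ if and only if $\log \mathrm{Vol}$ is concave on $\mathbb{R}^n$; in this case $1/\mathrm{Vol}$ is convex. 3. If $\mathrm{Ric} = 0$, then $\log\mathrm{Vol}$ is an affine function on $\mathbb{R}^n$; thus for all $x, v \in \mathbb{R}^n$ there is $a \in \mathbb{R}$ such that, for all $s \in \mathbb{R}$, $\log\mathrm{Vol}(x + s v) = \log\mathrm{Vol}(x) + a s$ and $\mathrm{Vol}(x+sv) = \mathrm{Vol}(x)\, e^{a s}$. -/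

import Mathlib

set_option maxSynthPendingDepth 3

noncomputable section

namespace ToricKahler

/-! ### Riemannian geometry in a chart -/

section Riemannian

variable {E : Type*} [NormedAddCommGroup E] [NormedSpace ℝ E]

/-- The first-kind Christoffel symbols of a metric tensor `g` given on an open subset of `E`:
`Γ(u, v; w) = 1/2 (∂_u g(v, w) + ∂_v g(u, w) - ∂_w g(u, v))`. -/
def koszul (g : E → E →L[ℝ] E →L[ℝ] ℝ) (p : E) : E →L[ℝ] E →L[ℝ] E →L[ℝ] ℝ :=
  (1 / 2 : ℝ) • (fderiv ℝ g p + (fderiv ℝ g p).flip -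
    ((ContinuousLinearMap.flipₗᵢ ℝ E E ℝ).toContinuousLinearEquiv :
      (E →L[ℝ] E →L[ℝ] ℝ) →L[ℝ] (E →L[ℝ] E →L[ℝ] ℝ)).comp (fderiv ℝ g p).flip)

theorem koszul_apply (g : E → E →L[ℝ] E →L[ℝ] ℝ) (p u v w : E) :
    koszul g p u v w =
      (1 / 2) * (fderiv ℝ g p u v w + fderiv ℝ g p v u w - fderiv ℝ g p w u v) := by
  simp [koszul]

/-- The Christoffel symbols `Γ(u, v)` of the Levi-Civita connection of `g`, so that
`∇_X Y = D_X Y + Γ(X, Y)`: the first-kind symbols with the last index raised by the inverse of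
`g p : E → E*`. -/
def christoffel (g : E → E →L[ℝ] E →L[ℝ] ℝ) (p : E) : E →L[ℝ] E →L[ℝ] E :=
  (ContinuousLinearMap.compL ℝ E (E →L[ℝ] ℝ) E (ContinuousLinearMap.inverse (g p))).comp
    (koszul g p)

theorem christoffel_apply (g : E → E →L[ℝ] E →L[ℝ] ℝ) (p u v : E) :
    christoffel g p u v = ContinuousLinearMap.inverse (g p) (koszul g p u v) := by
  simp [christoffel]

/-- The linear map `u ↦ R(u, v) w`, where `R(u, v) w = ∇_u ∇_v w - ∇_v ∇_u w` (for constant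
vector fields `u, v, w`) is the curvature tensor of the Levi-Civita connection. -/
def curvature (g : E → E →L[ℝ] E →L[ℝ] ℝ) (p v w : E) : E →L[ℝ] E :=
  ((fderiv ℝ (christoffel g) p).flip v).flip w - (fderiv ℝ (christoffel g) p v).flip w
    + (christoffel g p).flip (christoffel g p v w)
    - (christoffel g p v).comp ((christoffel g p).flip w)

theorem curvature_apply (g : E → E →L[ℝ] E →L[ℝ] ℝ) (p u v w : E) :
    curvature g p v w u =
      fderiv ℝ (christoffel g) p u v w - fderiv ℝ (christoffel g) p v u w
        + christoffel g p u (christoffel g p v w) - christoffel g p v (christoffel g p u w) := by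
  simp [curvature]

/-- The Ricci tensor `Ric(v, w) = tr (u ↦ R(u, v) w)` of the metric `g`. -/
def ricci (g : E → E →L[ℝ] E →L[ℝ] ℝ) (p v w : E) : ℝ :=
  LinearMap.trace ℝ E (curvature g p v w : E →ₗ[ℝ] E)

/-- The Riemannian `n`-dimensional volume, with respect to `g`, of a submanifold parametrized
by `γ : D → E` with `D ⊆ ℝⁿ`. -/
def paramVolume {n : ℕ} (g : E → E →L[ℝ] E →L[ℝ] ℝ) (D : Set (Fin n → ℝ))
    (γ : (Fin n → ℝ) → E) : ℝ :=
  ∫ θ in D, Real.sqrt (Matrix.det (Matrix.of fun i j : Fin n =>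
    g (γ θ) (fderiv ℝ γ θ (Pi.single i 1)) (fderiv ℝ γ θ (Pi.single j 1))))

/-- A `2`-form at a point, as a bilinear map. -/
def formToBilin (ω : E [⋀^Fin 2]→L[ℝ] ℝ) : E →L[ℝ] E →L[ℝ] ℝ :=
  ((continuousMultilinearCurryFin1 ℝ E ℝ).toContinuousLinearEquiv :
    (E [×1]→L[ℝ] ℝ) →L[ℝ] (E →L[ℝ] ℝ)).comp ω.toContinuousMultilinearMap.curryLeft

theorem formToBilin_apply (ω : E [⋀^Fin 2]→L[ℝ] ℝ) (u v : E) :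
    formToBilin ω u v = ω ![u, v] := by
  simp [formToBilin]

end Riemannian

/-! ### The complex torus and the action of the compact torus -/

variable {n : ℕ}

/-- `(ℂ*)ⁿ` as an open subset of `ℂⁿ`. -/
def cstar (n : ℕ) : Set (Fin n → ℂ) := {z | ∀ j, z j ≠ 0}

/-- The action of the torus `𝕋ⁿ = U(1)ⁿ` on `ℂⁿ` by coordinatewise multiplication. -/
def torusAct (t : Fin n → Circle) (z : Fin n → ℂ) : Fin n → ℂ := fun j => (t j : ℂ) * z j

/-- The exponential map from the Lie algebra `ℝⁿ` of `𝕋ⁿ`. -/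
def torusExp (θ : Fin n → ℝ) : Fin n → Circle := fun j => Circle.exp (θ j)

/-- The fundamental vector field on `(ℂ*)ⁿ` of the element `X` of the Lie algebra of `𝕋ⁿ`. -/
def fundField (X : Fin n → ℝ) (z : Fin n → ℂ) : Fin n → ℂ :=
  fun j => (X j : ℂ) * Complex.I * z j

theorem hasDerivAt_fundField (X : Fin n → ℝ) (z : Fin n → ℂ) :
    HasDerivAt (fun s : ℝ => torusAct (torusExp (s • X)) z) (fundField X z) 0 := by
  rw [hasDerivAt_pi]
  intro j
  have h1 : HasDerivAt (fun s : ℝ => ((s * X j : ℝ) : ℂ) * Complex.I)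
      ((X j : ℂ) * Complex.I) 0 := by
    have h := ((hasDerivAt_id (0 : ℝ)).mul_const (X j)).ofReal_comp.mul_const Complex.I
    simpa using h
  have h2 := (h1.cexp).mul_const (z j)
  simpa [torusAct, torusExp, fundField, Circle.coe_exp] using h2

/-- The point `exp(x)` of `(ℂ*)ⁿ`. -/
def expPoint (x : Fin n → ℝ) : Fin n → ℂ := fun j => Complex.exp (x j : ℂ)

/-- Each torus orbit in `(ℂ*)ⁿ` contains exactly one point `exp(x)` with `x ∈ ℝⁿ`; this is the
identification of the orbit space with `ℝⁿ`. -/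
theorem existsUnique_expPoint (z : Fin n → ℂ) (hz : z ∈ cstar n) :
    ∃! x : Fin n → ℝ, ∃ t : Fin n → Circle, torusAct t (expPoint x) = z := by
  refine ⟨fun j => Real.log ‖z j‖, ⟨fun j => Circle.exp (Complex.arg (z j)), ?_⟩, ?_⟩
  · funext j
    have h : (0 : ℝ) < ‖z j‖ := norm_pos_iff.mpr (hz j)
    simp only [torusAct, expPoint, Circle.coe_exp]
    rw [← Complex.ofReal_exp, Real.exp_log h, mul_comm]
    exact Complex.norm_mul_exp_arg_mul_I (z j)
  · rintro y ⟨t, ht⟩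
    funext j
    have h : z j = (t j : ℂ) * Complex.exp (y j : ℂ) := (congrFun ht j).symm
    rw [h, norm_mul, Circle.norm_coe, one_mul, ← Complex.ofReal_exp, Complex.norm_real,
      Real.norm_eq_abs, Real.abs_exp, Real.log_exp]

/-! ### Kähler forms, moment maps and volumes of orbits -/

/-- `ω` is a Kähler form on `(ℂ*)ⁿ` with its standard complex structure: a smooth closed real
`(1,1)`-form (that is, a `2`-form invariant under multiplication by `i`) which is positive. -/
structure IsKahlerForm (ω : (Fin n → ℂ) → (Fin n → ℂ) [⋀^Fin 2]→L[ℝ] ℝ) : Prop where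
  smooth : ContDiffOn ℝ ((⊤ : ℕ∞) : WithTop ℕ∞) ω (cstar n)
  closed : ∀ z ∈ cstar n, extDeriv ω z = 0
  compatible : ∀ z ∈ cstar n, ∀ u v : Fin n → ℂ,
    ω z ![Complex.I • u, Complex.I • v] = ω z ![u, v]
  positive : ∀ z ∈ cstar n, ∀ v : Fin n → ℂ, v ≠ 0 → 0 < ω z ![v, Complex.I • v]

/-- `μ` is a moment map for the torus action on `(ℂ*)ⁿ`: `d(μ·X) = ι_X̃ ω` and `μ` is
equivariant for the coadjoint action, which is trivial since the torus is Abelian. -/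
structure IsMomentMap (ω : (Fin n → ℂ) → (Fin n → ℂ) [⋀^Fin 2]→L[ℝ] ℝ)
    (μ : (Fin n → ℂ) → (Fin n → ℝ) →L[ℝ] ℝ) : Prop where
  differentiableAt : ∀ z ∈ cstar n, DifferentiableAt ℝ μ z
  fderiv_eq : ∀ X : Fin n → ℝ, ∀ z ∈ cstar n, ∀ v : Fin n → ℂ,
    fderiv ℝ (fun y => μ y X) z v = ω z ![fundField X z, v]
  equivariant : ∀ t : Fin n → Circle, ∀ z ∈ cstar n, μ (torusAct t z) = μ z

/-- The torus action on `((ℂ*)ⁿ, ω)` is Hamiltonian. -/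
def IsHamiltonian (ω : (Fin n → ℂ) → (Fin n → ℂ) [⋀^Fin 2]→L[ℝ] ℝ) : Prop :=
  ∃ μ : (Fin n → ℂ) → (Fin n → ℝ) →L[ℝ] ℝ, IsMomentMap ω μ

/-- The Riemannian metric `g(u, v) = ω(u, Jv)` of a Kähler form. -/
def kahlerMetric (ω : (Fin n → ℂ) → (Fin n → ℂ) [⋀^Fin 2]→L[ℝ] ℝ) (z : Fin n → ℂ) :
    (Fin n → ℂ) →L[ℝ] (Fin n → ℂ) →L[ℝ] ℝ :=
  (formToBilin (ω z)).bilinearComp (ContinuousLinearMap.id ℝ (Fin n → ℂ))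
    (Complex.I • ContinuousLinearMap.id ℝ (Fin n → ℂ))

theorem kahlerMetric_apply (ω : (Fin n → ℂ) → (Fin n → ℂ) [⋀^Fin 2]→L[ℝ] ℝ)
    (z u v : Fin n → ℂ) : kahlerMetric ω z u v = ω z ![u, Complex.I • v] := by
  simp [kahlerMetric, formToBilin_apply]

/-- The Hermitian metric `h = g - iω`, complex linear in its first argument. -/
def kahlerHermitian (ω : (Fin n → ℂ) → (Fin n → ℂ) [⋀^Fin 2]→L[ℝ] ℝ) (z u v : Fin n → ℂ) : ℂ :=
  (kahlerMetric ω z u v : ℂ) - Complex.I * (ω z ![u, v] : ℂ)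

/-- `H = det h(X̃_i, X̃_j)`, for the standard basis `X_i` of the Lie algebra of the torus. -/
def detH (ω : (Fin n → ℂ) → (Fin n → ℂ) [⋀^Fin 2]→L[ℝ] ℝ) (z : Fin n → ℂ) : ℂ :=
  Matrix.det (Matrix.of fun i j : Fin n =>
    kahlerHermitian ω z (fundField (Pi.single i 1) z) (fundField (Pi.single j 1) z))

/-- The cube `[0, 2π)ⁿ`. -/
def angleBox (n : ℕ) : Set (Fin n → ℝ) :=
  Set.univ.pi fun _ => Set.Ico 0 (2 * Real.pi)

/-- `θ ↦ exp(θ) · z` parametrizes the orbit of `z` bijectively by `[0, 2π)ⁿ`. -/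
theorem bijOn_orbit (z : Fin n → ℂ) (hz : z ∈ cstar n) :
    Set.BijOn (fun θ => torusAct (torusExp θ) z) (angleBox n)
      (Set.range fun t : Fin n → Circle => torusAct t z) := by
  refine ⟨fun θ _ => ⟨torusExp θ, rfl⟩, ?_, ?_⟩
  · intro a ha b hb hab
    funext j
    have h : ((Circle.exp (a j) : Circle) : ℂ) * z j = (Circle.exp (b j) : ℂ) * z j :=
      congrFun hab j
    have h' : Circle.exp (a j) = Circle.exp (b j) := Circle.ext (mul_right_cancel₀ (hz j) h)
    obtain ⟨m, hm⟩ := Circle.exp_eq_exp.mp h'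
    have ha' := ha j trivial
    have hb' := hb j trivial
    simp only [Set.mem_Ico] at ha' hb'
    have hpi := Real.pi_pos
    have hm0 : m = 0 := by
      have h1 : (m : ℝ) < 1 := by nlinarith
      have h2 : (-1 : ℝ) < m := by nlinarith
      have h1' : m < 1 := by exact_mod_cast h1
      have h2' : -1 < m := by exact_mod_cast h2
      omega
    simpa [hm0] using hm
  · rintro _ ⟨t, rfl⟩
    refine ⟨fun j => toIcoMod Real.two_pi_pos 0 (Complex.arg (t j)), ?_, ?_⟩
    · intro j _
      simpa using toIcoMod_mem_Ico Real.two_pi_pos 0 (Complex.arg (t j))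
    · funext j
      have : Circle.exp (toIcoMod Real.two_pi_pos 0 (Complex.arg (t j))) = t j := by
        rw [toIcoMod, zsmul_eq_mul, Circle.periodic_exp.sub_int_mul_eq, Circle.exp_arg]
      simp [torusAct, torusExp, this]

/-- The Riemannian volume of the torus orbit through `z`. -/
def orbitVolume (ω : (Fin n → ℂ) → (Fin n → ℂ) [⋀^Fin 2]→L[ℝ] ℝ) (z : Fin n → ℂ) : ℝ :=
  paramVolume (kahlerMetric ω) (angleBox n) fun θ => torusAct (torusExp θ) z

/-- The volume functional on the orbit space `(ℂ*)ⁿ / 𝕋ⁿ ≃ ℝⁿ`, where `x ∈ ℝⁿ` corresponds to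
the orbit of `exp(x)`. -/
def vol (ω : (Fin n → ℂ) → (Fin n → ℂ) [⋀^Fin 2]→L[ℝ] ℝ) (x : Fin n → ℝ) : ℝ :=
  orbitVolume ω (expPoint x)

end ToricKahler

end

namespace ToricKahler

/-! ### Riemannian metrics on open subsets of a vector space -/

section Levi

variable {E : Type*} [NormedAddCommGroup E] [NormedSpace ℝ E]

/-! For a Kähler metric the complex structure `J` is parallel, and the first Bianchi identity then
rewrites the Ricci trace through the endomorphism `R(v, Jv)`. Composed with `J`, its quadratic part
in the Christoffel symbols is a commutator and has zero trace. Hence `Ric(v, v)` is minus one half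
of the sum of `tr (D_v Γ)(v)` and `tr (D_{Jv} Γ)(Jv)` (`IsKahlerOn.ricci_eq`), which involves only
the contracted symbols `tr Γ(v)`.

These contracted symbols are a logarithmic derivative. The moment map is constant on orbits, so
orbits are isotropic and `H` is the real Gram determinant of the fundamental fields. Those fields
form a holomorphic frame, and Jacobi's formula gives `D_v log H = tr Γ(v) + 2 ∑ Re(v_k / z_k)`
(`hasDerivAt_gram_det`). By invariance `log H` is a function of `x_j = log |z_j|` alone. The
additional term is the derivative of the pluriharmonic function `2 ∑ log |z_k|`, and it disappears
when the contributions of `v` and `Jv` are added. What remains is the Hessian of `log H` in `x`,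
evaluated at `Re(v/z)` and at `Re(iv/z)` (`ricci_eq_hessian`).

The Gram matrix is constant along an orbit, so `Vol = (2π)^n √H` and `log Vol` is `log H / 2` up to
a constant. Thus `Ric(v, v)` is minus a sum of two Hessian values of `log Vol`. For `v = a z` with
`a` real the second value vanishes, so every Hessian value occurs (`ricci_expPoint`). Signs of the
Ricci form and of the Hessian therefore correspond exactly. -/

theorem curvature_antisymm (g : E → E →L[ℝ] E →L[ℝ] ℝ) (p u v w : E) :
    curvature g p v w u = -curvature g p u w v := by
  rw [curvature_apply, curvature_apply]
  abel

/-- `g` is a smooth Riemannian metric on the open set `U`. -/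
structure IsRiemannianOn (g : E → E →L[ℝ] E →L[ℝ] ℝ) (U : Set E) : Prop where
  isOpen : IsOpen U
  smooth : ContDiffOn ℝ ((⊤ : ℕ∞) : WithTop ℕ∞) g U
  symm : ∀ p ∈ U, ∀ u v, g p u v = g p v u
  pos : ∀ p ∈ U, ∀ v, v ≠ 0 → 0 < g p v v

namespace IsRiemannianOn

variable {g : E → E →L[ℝ] E →L[ℝ] ℝ} {U : Set E} {p : E}

theorem contDiffAt (hg : IsRiemannianOn g U) (hp : p ∈ U) :
    ContDiffAt ℝ ((⊤ : ℕ∞) : WithTop ℕ∞) g p :=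
  hg.smooth.contDiffAt (hg.isOpen.mem_nhds hp)

theorem differentiableAt (hg : IsRiemannianOn g U) (hp : p ∈ U) : DifferentiableAt ℝ g p :=
  (hg.contDiffAt hp).differentiableAt (by simp)

theorem contDiffAt_fderiv (hg : IsRiemannianOn g U) (hp : p ∈ U) :
    ContDiffAt ℝ ((⊤ : ℕ∞) : WithTop ℕ∞) (fderiv ℝ g) p :=
  (hg.contDiffAt hp).fderiv_right (by exact_mod_cast le_rfl)

theorem ext_of_metric (hg : IsRiemannianOn g U) (hp : p ∈ U) {u v : E}
    (h : ∀ w, g p u w = g p v w) : u = v := by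
  by_contra hne
  have := hg.pos p hp (u - v) (sub_ne_zero.mpr hne)
  simp [h] at this

theorem fderiv_symm (hg : IsRiemannianOn g U) (hp : p ∈ U) (u v w : E) :
    fderiv ℝ g p u v w = fderiv ℝ g p u w v := by
  have h1 : ∀ v w : E, fderiv ℝ (fun q => g q v w) p u = fderiv ℝ g p u v w := by
    intro v w
    have := (((hg.differentiableAt hp).hasFDerivAt.clm_apply (hasFDerivAt_const v p)).clm_apply
      (hasFDerivAt_const w p)).fderiv
    rw [this]; simp
  rw [← h1, ← h1]
  congr 1
  apply Filter.EventuallyEq.fderiv_eq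
  filter_upwards [hg.isOpen.mem_nhds hp] with q hq using hg.symm q hq v w

theorem koszul_symm (hg : IsRiemannianOn g U) (hp : p ∈ U) (u v : E) :
    koszul g p u v = koszul g p v u := by
  ext w
  rw [koszul_apply, koszul_apply, hg.fderiv_symm hp w u v]
  ring

theorem christoffel_symm (hg : IsRiemannianOn g U) (hp : p ∈ U) (u v : E) :
    christoffel g p u v = christoffel g p v u := by
  rw [christoffel_apply, christoffel_apply, hg.koszul_symm hp]

theorem contDiffAt_koszul (hg : IsRiemannianOn g U) (hp : p ∈ U) :
    ContDiffAt ℝ ((⊤ : ℕ∞) : WithTop ℕ∞) (koszul g) p := by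
  have h := hg.contDiffAt_fderiv hp
  have h' : ContDiffAt ℝ ((⊤ : ℕ∞) : WithTop ℕ∞) (fun q => (fderiv ℝ g q).flip) p :=
    ((ContinuousLinearMap.flipₗᵢ ℝ E E (E →L[ℝ] ℝ)).toContinuousLinearEquiv :
      (E →L[ℝ] E →L[ℝ] E →L[ℝ] ℝ) →L[ℝ] (E →L[ℝ] E →L[ℝ] E →L[ℝ] ℝ)).contDiff.contDiffAt.comp p h
  exact ((h.add h').sub (contDiffAt_const.clm_comp h')).const_smul (1 / 2 : ℝ)

variable [FiniteDimensional ℝ E]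

/-- Positivity makes the map into the dual injective, and the dual has the same finite dimension. -/
theorem isInvertible (hg : IsRiemannianOn g U) (hp : p ∈ U) : (g p).IsInvertible := by
  have hinj : Function.Injective (g p : E →ₗ[ℝ] E →L[ℝ] ℝ) := fun u v h =>
    hg.ext_of_metric hp fun w => DFunLike.congr_fun h w
  have hfin : Module.finrank ℝ E = Module.finrank ℝ (E →L[ℝ] ℝ) := by
    rw [← (LinearMap.toContinuousLinearMap : (E →ₗ[ℝ] ℝ) ≃ₗ[ℝ] (E →L[ℝ] ℝ)).finrank_eq]
    exact (Subspace.dual_finrank_eq (K := ℝ) (V := E)).symm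
  exact ⟨(LinearEquiv.ofInjectiveOfFinrankEq _ hinj hfin).toContinuousLinearEquiv, by ext; rfl⟩

theorem metric_christoffel (hg : IsRiemannianOn g U) (hp : p ∈ U) (u v w : E) :
    g p (christoffel g p u v) w = koszul g p u v w := by
  rw [christoffel_apply, (hg.isInvertible hp).self_apply_inverse]

theorem contDiffAt_christoffel (hg : IsRiemannianOn g U) (hp : p ∈ U) :
    ContDiffAt ℝ ((⊤ : ℕ∞) : WithTop ℕ∞) (christoffel g) p := by
  have : CompleteSpace E := FiniteDimensional.complete ℝ E
  have h : ContDiffAt ℝ ((⊤ : ℕ∞) : WithTop ℕ∞)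
      (fun q => ContinuousLinearMap.inverse (g q)) p :=
    (hg.isInvertible hp).contDiffAt_map_inverse.comp p (hg.contDiffAt hp)
  exact ((ContinuousLinearMap.compL ℝ E (E →L[ℝ] ℝ) E).contDiff.contDiffAt.comp p h).clm_comp
    (hg.contDiffAt_koszul hp)

theorem differentiableAt_christoffel (hg : IsRiemannianOn g U) (hp : p ∈ U) :
    DifferentiableAt ℝ (christoffel g) p :=
  (hg.contDiffAt_christoffel hp).differentiableAt (by simp)

/-- The Levi-Civita connection is compatible with the metric. -/
theorem fderiv_eq_christoffel (hg : IsRiemannianOn g U) (hp : p ∈ U) (u v w : E) :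
    fderiv ℝ g p u v w = g p (christoffel g p u v) w + g p v (christoffel g p u w) := by
  rw [hg.symm p hp v, hg.metric_christoffel hp, hg.metric_christoffel hp, koszul_apply,
    koszul_apply, hg.fderiv_symm hp u w v, hg.fderiv_symm hp v u w, hg.fderiv_symm hp w u v]
  ring

theorem hasFDerivAt_christoffel (hg : IsRiemannianOn g U) (hp : p ∈ U) (v w : E) :
    HasFDerivAt (fun q => christoffel g q v w)
      (((fderiv ℝ (christoffel g) p).flip v).flip w) p := by
  have := (((hg.differentiableAt_christoffel hp).hasFDerivAt.clm_apply
    (hasFDerivAt_const v p)).clm_apply (hasFDerivAt_const w p))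
  convert this using 1
  ext; simp

theorem fderiv_christoffel_symm (hg : IsRiemannianOn g U) (hp : p ∈ U) (u v w : E) :
    fderiv ℝ (christoffel g) p u v w = fderiv ℝ (christoffel g) p u w v := by
  have h : (fun q => christoffel g q v w) =ᶠ[nhds p] fun q => christoffel g q w v := by
    filter_upwards [hg.isOpen.mem_nhds hp] with q hq using hg.christoffel_symm hq v w
  have h' := (hg.hasFDerivAt_christoffel hp v w).unique
    ((hg.hasFDerivAt_christoffel hp w v).congr_of_eventuallyEq h)
  simpa using DFunLike.congr_fun h' u

/-- The first Bianchi identity. -/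
theorem bianchi (hg : IsRiemannianOn g U) (hp : p ∈ U) (u v w : E) :
    curvature g p v w u + curvature g p w u v + curvature g p u v w = 0 := by
  simp only [curvature_apply]
  rw [hg.fderiv_christoffel_symm hp u v w, hg.fderiv_christoffel_symm hp v u w,
    hg.fderiv_christoffel_symm hp w u v, hg.christoffel_symm hp v w, hg.christoffel_symm hp u w,
    hg.christoffel_symm hp v u]
  abel

/-- Metric compatibility is differentiated once more, and each derivative of `g` that appears is
replaced by compatibility again. -/
theorem fderiv_fderiv_eq (hg : IsRiemannianOn g U) (hp : p ∈ U) (u v w x : E) :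
    fderiv ℝ (fderiv ℝ g) p v u w x =
      g p (fderiv ℝ (christoffel g) p v u w) x + g p w (fderiv ℝ (christoffel g) p v u x)
      + g p (christoffel g p v (christoffel g p u w)) x
      + g p (christoffel g p u w) (christoffel g p v x)
      + g p (christoffel g p v w) (christoffel g p u x)
      + g p w (christoffel g p v (christoffel g p u x)) := by
  have h1 : HasFDerivAt (fun q => fderiv ℝ g q u w x) _ p :=
    (((((hg.contDiffAt_fderiv hp).differentiableAt (by simp)).hasFDerivAt.clm_apply
      (hasFDerivAt_const u p)).clm_apply (hasFDerivAt_const w p)).clm_apply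
      (hasFDerivAt_const x p))
  have hg' := (hg.differentiableAt hp).hasFDerivAt
  have h2 := ((hg'.clm_apply (hg.hasFDerivAt_christoffel hp u w)).clm_apply
    (hasFDerivAt_const x p)).add
    ((hg'.clm_apply (hasFDerivAt_const w p)).clm_apply (hg.hasFDerivAt_christoffel hp u x))
  have h : (fun q => fderiv ℝ g q u w x) =ᶠ[nhds p]
      fun q => g q (christoffel g q u w) x + g q w (christoffel g q u x) := by
    filter_upwards [hg.isOpen.mem_nhds hp] with q hq using hg.fderiv_eq_christoffel hq u w x
  have h' := DFunLike.congr_fun (h1.unique (h2.congr_of_eventuallyEq h)) v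
  simp at h'
  rw [h', hg.fderiv_eq_christoffel hp, hg.fderiv_eq_christoffel hp]
  ring

/-- Second derivatives of `g` commute. Antisymmetrizing their expansion in Christoffel symbols
leaves exactly the part of the curvature symmetric in `w` and `x`, which must vanish. -/
theorem metric_curvature_antisymm (hg : IsRiemannianOn g U) (hp : p ∈ U) (u v w x : E) :
    g p (curvature g p v w u) x = -g p (curvature g p v x u) w := by
  have hs : fderiv ℝ (fderiv ℝ g) p v u = fderiv ℝ (fderiv ℝ g) p u v :=
    ((hg.contDiffAt hp).isSymmSndFDerivAt
      (by rw [minSmoothness_of_isRCLikeNormedField]; exact WithTop.coe_le_coe.mpr le_top)).eq v u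
  have h := DFunLike.congr_fun (DFunLike.congr_fun hs w) x
  rw [hg.fderiv_fderiv_eq hp, hg.fderiv_fderiv_eq hp] at h
  rw [hg.symm p hp _ w]
  simp only [curvature_apply, map_add, map_sub, add_apply, sub_apply]
  linarith

/-- The pair symmetry of the curvature tensor. -/
theorem metric_curvature_pair_symm (hg : IsRiemannianOn g U) (hp : p ∈ U) (u v w x : E) :
    g p (curvature g p v w u) x = g p (curvature g p x u w) v := by
  have a : ∀ u v w x, g p (curvature g p v w u) x = -g p (curvature g p u w v) x := by
    intro u v w x
    rw [curvature_antisymm]; simp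
  have b := hg.metric_curvature_antisymm hp
  have c : ∀ u v w x, g p (curvature g p v w u) x + g p (curvature g p w u v) x +
      g p (curvature g p u v w) x = 0 := by
    intro u v w x
    have := congrArg (fun y => g p y x) (hg.bianchi hp u v w)
    simpa using this
  -- The classical octahedron argument: four Bianchi identities are combined, and the two skew
  -- symmetries cancel all terms but the wanted pair.
  linarith [c v w u x, c w u x v, c u x v w, c x v w u, b v w u x, b w u v x, b u x w v,
    b x v u w, b u v w x, b w x u v, a v u x w, a x w u v]

end IsRiemannianOn

end Levi

end ToricKahler

namespace ToricKahler

/-! ### The Ricci tensor of a Kähler metric -/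

section Kahler

variable {E : Type*} [NormedAddCommGroup E] [NormedSpace ℝ E]

/-- The trace of a continuous endomorphism as a continuous linear functional. -/
noncomputable def traceCLM (E : Type*) [NormedAddCommGroup E] [NormedSpace ℝ E]
    [FiniteDimensional ℝ E] : (E →L[ℝ] E) →L[ℝ] ℝ :=
  LinearMap.toContinuousLinearMap ((LinearMap.trace ℝ E).comp (ContinuousLinearMap.coeLM ℝ))

theorem traceCLM_apply [FiniteDimensional ℝ E] (A : E →L[ℝ] E) :
    traceCLM E A = LinearMap.trace ℝ E (A : E →ₗ[ℝ] E) := rfl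

theorem traceCLM_comp_comm [FiniteDimensional ℝ E] (A B : E →L[ℝ] E) :
    traceCLM E (A.comp B) = traceCLM E (B.comp A) :=
  LinearMap.trace_mul_comm ℝ (A : E →ₗ[ℝ] E) (B : E →ₗ[ℝ] E)

/-- `g` is a Kähler metric on the open set `U` for the constant complex structure `J`. -/
structure IsKahlerOn (g : E → E →L[ℝ] E →L[ℝ] ℝ) (J : E →L[ℝ] E) (U : Set E) : Prop
    extends IsRiemannianOn g U where
  sq : ∀ u, J (J u) = -u
  orthogonal : ∀ p ∈ U, ∀ u v, g p (J u) (J v) = g p u v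
  closed : ∀ p ∈ U, ∀ u v w,
    fderiv ℝ g p u (J v) w + fderiv ℝ g p v (J w) u + fderiv ℝ g p w (J u) v = 0

namespace IsKahlerOn

variable {g : E → E →L[ℝ] E →L[ℝ] ℝ} {J : E →L[ℝ] E} {U : Set E} {p : E}

theorem fderiv_orthogonal (hg : IsKahlerOn g J U) (hp : p ∈ U) (u v w : E) :
    fderiv ℝ g p u (J v) (J w) = fderiv ℝ g p u v w := by
  have h1 : ∀ v w : E, fderiv ℝ (fun q => g q v w) p u = fderiv ℝ g p u v w := by
    intro v w
    have := (((hg.differentiableAt hp).hasFDerivAt.clm_apply (hasFDerivAt_const v p)).clm_apply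
      (hasFDerivAt_const w p)).fderiv
    rw [this]; simp
  rw [← h1, ← h1]
  congr 1
  apply Filter.EventuallyEq.fderiv_eq
  filter_upwards [hg.isOpen.mem_nhds hp] with q hq using hg.orthogonal q hq v w

theorem metric_J_left (hg : IsKahlerOn g J U) (hp : p ∈ U) (u v : E) :
    g p (J u) v = -g p u (J v) := by
  rw [← hg.orthogonal p hp (J u), hg.sq]; simp

theorem fderiv_J_left (hg : IsKahlerOn g J U) (hp : p ∈ U) (u v w : E) :
    fderiv ℝ g p u (J v) w = -fderiv ℝ g p u v (J w) := by
  rw [← hg.fderiv_orthogonal hp u (J v), hg.sq]; simp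

variable [FiniteDimensional ℝ E]

/-- The complex structure of a Kähler metric is parallel. -/
theorem christoffel_J_right (hg : IsKahlerOn g J U) (hp : p ∈ U) (u v : E) :
    christoffel g p u (J v) = J (christoffel g p u v) := by
  refine hg.ext_of_metric hp fun w => ?_
  rw [hg.metric_J_left hp, hg.metric_christoffel hp, hg.metric_christoffel hp, koszul_apply,
    koszul_apply]
  -- In the difference of these two instances of closedness the `u`-derivatives cancel; the rest is
  -- the required identity between Koszul expressions.
  have h1 := hg.closed p hp v w u
  have h2 := hg.closed p hp (J v) (J w) u
  simp only [hg.sq, hg.fderiv_J_left hp, map_neg, neg_apply, neg_neg] at h1 h2 ⊢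
  rw [hg.fderiv_symm hp v w, hg.fderiv_J_left hp v u] at h1
  rw [hg.fderiv_symm hp (J v) w] at h2
  linarith [hg.fderiv_J_left hp v u w, hg.fderiv_symm hp v w (J u)]

theorem fderiv_christoffel_J_right (hg : IsKahlerOn g J U) (hp : p ∈ U) (u v w : E) :
    fderiv ℝ (christoffel g) p u v (J w) = J (fderiv ℝ (christoffel g) p u v w) := by
  have h : (fun q => christoffel g q v (J w)) =ᶠ[nhds p] fun q => J (christoffel g q v w) := by
    filter_upwards [hg.isOpen.mem_nhds hp] with q hq using hg.christoffel_J_right hq v w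
  have h' := (hg.hasFDerivAt_christoffel hp v (J w)).unique
    ((J.hasFDerivAt.comp p (hg.hasFDerivAt_christoffel hp v w)).congr_of_eventuallyEq h)
  simpa using DFunLike.congr_fun h' u

theorem curvature_J_right (hg : IsKahlerOn g J U) (hp : p ∈ U) (u v w : E) :
    curvature g p v (J w) u = J (curvature g p v w u) := by
  simp only [curvature_apply, hg.fderiv_christoffel_J_right hp, hg.christoffel_J_right hp,
    map_add, map_sub]

/-- Pair symmetry moves `J` to the other pair of arguments, where it commutes with the curvature and
is orthogonal. -/
theorem curvature_J_J (hg : IsKahlerOn g J U) (hp : p ∈ U) (u v w : E) :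
    curvature g p (J v) w (J u) = curvature g p v w u := by
  refine hg.ext_of_metric hp fun x => ?_
  rw [hg.metric_curvature_pair_symm hp, hg.curvature_J_right hp, hg.orthogonal p hp,
    ← hg.metric_curvature_pair_symm hp]

/-- Here `B` is `x ↦ R(v, w) x`. Since `J` commutes with the Christoffel operators, `J [Γ(v), Γ(w)]`
is itself a commutator and is traceless, so only the derivative terms survive. -/
theorem trace_J_comp_curvature (hg : IsKahlerOn g J U) (hp : p ∈ U) (v w : E)
    (B : E →L[ℝ] E) (hB : ∀ x, B x = curvature g p w x v) :
    traceCLM E (J.comp B) = traceCLM E (fderiv ℝ (christoffel g) p v (J w))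
      - traceCLM E (fderiv ℝ (christoffel g) p w (J v)) := by
  have hD : ∀ u v, fderiv ℝ (christoffel g) p u (J v) =
      J.comp (fderiv ℝ (christoffel g) p u v) := by
    intro u v
    ext x
    rw [hg.fderiv_christoffel_symm hp, hg.fderiv_christoffel_J_right hp,
      hg.fderiv_christoffel_symm hp]
    rfl
  have hBe : J.comp B = fderiv ℝ (christoffel g) p v (J w) - fderiv ℝ (christoffel g) p w (J v)
      + ((J.comp (christoffel g p v)).comp (christoffel g p w)
        - (christoffel g p w).comp (J.comp (christoffel g p v))) := by
    ext x
    simp only [hD, add_apply, sub_apply, ContinuousLinearMap.comp_apply, hB, curvature_apply,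
      map_add, map_sub, hg.christoffel_J_right hp]
    abel
  rw [hBe, map_add, map_sub, map_sub, traceCLM_comp_comm (J.comp (christoffel g p v))]
  ring

/-- The Ricci curvature of a Kähler metric in terms of the contracted Christoffel symbols. -/
theorem ricci_eq (hg : IsKahlerOn g J U) (hp : p ∈ U) (v : E) :
    ricci g p v v = -(1 / 2) * (traceCLM E (fderiv ℝ (christoffel g) p v v)
      + traceCLM E (fderiv ℝ (christoffel g) p (J v) (J v))) := by
  -- With `C x = R(x, v) v`, whose trace is the Ricci curvature, Bianchi gives `R(v, Jv) = -(J C) -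
  -- C J`.
  have hB : ∀ x, (-(J.comp (curvature g p v v)) - (curvature g p v v).comp J) x =
      curvature g p (J v) x v := by
    intro x
    have h1 : curvature g p x v (J v) = curvature g p v v (J x) := by
      rw [curvature_antisymm, ← hg.curvature_J_J hp (J x), hg.sq, map_neg]
    have h := hg.bianchi hp v (J v) x
    rw [h1, hg.curvature_J_right hp] at h
    rw [add_assoc] at h
    rw [eq_neg_of_add_eq_zero_left h, sub_apply, neg_apply, ContinuousLinearMap.comp_apply,
      ContinuousLinearMap.comp_apply]
    abel
  have h := hg.trace_J_comp_curvature hp v (J v) _ hB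
  -- Composing with `J` gives `C - J C J`, whose trace is `2 tr C` by cyclicity and `J² = -1`.
  have hJ : J.comp (-(J.comp (curvature g p v v)) - (curvature g p v v).comp J) =
      curvature g p v v - (J.comp (curvature g p v v)).comp J := by
    ext x
    simp [hg.sq]
  have hJ' : J.comp (J.comp (curvature g p v v)) = -curvature g p v v := by
    ext x
    simp [hg.sq]
  rw [hJ, map_sub, traceCLM_comp_comm, hJ', hg.sq, map_neg, map_neg, map_neg] at h
  rw [ricci, ← traceCLM_apply]
  linarith

end IsKahlerOn

end Kahler

end ToricKahler

namespace ToricKahler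

/-! ### The determinant -/

/-- Jacobi's formula for the derivative of a determinant. -/
theorem hasDerivAt_det {n : ℕ} {M : ℝ → Matrix (Fin n) (Fin n) ℝ} {M' : Matrix (Fin n) (Fin n) ℝ}
    {s : ℝ} (h : ∀ i j, HasDerivAt (fun t => M t i j) (M' i j) s) :
    HasDerivAt (fun t => (M t).det) (((M s).adjugate * M').trace) s := by
  -- As a multilinear function of the rows, the determinant has as derivative the sum of
  -- determinants with one row replaced; Cramer's rule expresses these by the adjugate.
  let D : ContinuousMultilinearMap ℝ (fun _ : Fin n => Fin n → ℝ) ℝ :=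
    { (Matrix.detRowAlternating : (Fin n → ℝ) [⋀^Fin n]→ₗ[ℝ] ℝ).toMultilinearMap with
      cont := Continuous.matrix_det (A := fun x : Fin n → Fin n → ℝ => x) continuous_id }
  have hM : HasDerivAt (fun t => (M t : Fin n → Fin n → ℝ)) M' s :=
    hasDerivAt_pi.2 fun i => hasDerivAt_pi.2 fun j => h i j
  have := (D.hasFDerivAt (M s)).comp_hasDerivAt s hM
  convert! this using 1
  refine Eq.trans ?_ (D.linearDeriv_apply (fun i j => M s i j) (fun i j => M' i j)).symm
  rw [Matrix.trace_mul_comm, Matrix.trace]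
  refine Finset.sum_congr rfl fun i _ => ?_
  change _ = ((M s).updateRow i (M' i)).det
  rw [← Matrix.cramer_transpose_apply, Matrix.cramer_eq_adjugate_mulVec,
    ← Matrix.adjugate_transpose, Matrix.mulVec_transpose, Matrix.diag_apply, Matrix.mul_apply]
  rfl

/-! ### Trace of a complex linear map -/

/-- Multiplication by `i` on `ℂⁿ` as a real linear map. -/
noncomputable def mulI (n : ℕ) : (Fin n → ℂ) →L[ℝ] (Fin n → ℂ) :=
  Complex.I • ContinuousLinearMap.id ℝ (Fin n → ℂ)

variable {n : ℕ}

theorem mulI_apply (u : Fin n → ℂ) : mulI n u = Complex.I • u := rfl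

/-- In the real basis `1, i` a complex diagonal entry `a + ib` is a block with both diagonal entries
equal to `a`. -/
theorem traceCLM_eq_of_complexLinear (A : (Fin n → ℂ) →L[ℝ] (Fin n → ℂ))
    (hA : ∀ u, A (mulI n u) = mulI n (A u)) :
    traceCLM (Fin n → ℂ) A = 2 * ∑ k, (A (Pi.single k 1) k).re := by
  rw [traceCLM_apply,
    LinearMap.trace_eq_matrix_trace ℝ (Pi.basis fun _ : Fin n => Complex.basisOneI),
    Matrix.trace, Fintype.sum_sigma, Finset.mul_sum]
  refine Finset.sum_congr rfl fun k _ => ?_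
  have h1 : (Pi.single k Complex.I : Fin n → ℂ) = mulI n (Pi.single k 1) := by
    ext j
    by_cases h : j = k
    · subst h; simp [mulI_apply]
    · simp [mulI_apply, h]
  simp [Fin.sum_univ_two, LinearMap.toMatrix_apply, Pi.basis_apply, h1, hA]
  simp [mulI_apply]
  ring

/-! ### Kähler forms on `(ℂ*)ⁿ` -/

theorem isOpen_cstar (n : ℕ) : IsOpen (cstar n) := by
  have : cstar n = Set.univ.pi fun _ : Fin n => ({0}ᶜ : Set ℂ) := by
    ext z; simp [cstar]
  rw [this]
  exact isOpen_set_pi Set.finite_univ fun _ _ => isOpen_compl_singleton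

theorem form_antisymm {E : Type*} [NormedAddCommGroup E] [NormedSpace ℝ E]
    (ω : E [⋀^Fin 2]→L[ℝ] ℝ) (u v : E) : ω ![u, v] = -ω ![v, u] := by
  have h : ∀ w : E, formToBilin ω w w = 0 := fun w => by
    rw [formToBilin_apply]
    exact ω.map_eq_zero_of_eq ![w, w] (i := 0) (j := 1) (by simp) (by simp)
  have h' := h (u + v)
  simp only [map_add, add_apply, h] at h'
  rw [formToBilin_apply, formToBilin_apply] at h'
  linarith

namespace IsKahlerForm

variable {ω : (Fin n → ℂ) → (Fin n → ℂ) [⋀^Fin 2]→L[ℝ] ℝ} {z : Fin n → ℂ}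

theorem differentiableAt (hω : IsKahlerForm ω) (hz : z ∈ cstar n) : DifferentiableAt ℝ ω z :=
  (hω.smooth.contDiffAt ((isOpen_cstar n).mem_nhds hz)).differentiableAt (by simp)

theorem smooth_apply (hω : IsKahlerForm ω) (v : Fin 2 → Fin n → ℂ) :
    ContDiffOn ℝ ((⊤ : ℕ∞) : WithTop ℕ∞) (fun z => ω z v) (cstar n) :=
  ((ContinuousMultilinearMap.apply ℝ (fun _ : Fin 2 => Fin n → ℂ) ℝ v).comp
    (ContinuousAlternatingMap.toContinuousMultilinearMapCLM ℝ)).contDiff.comp_contDiffOn hω.smooth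

theorem smooth_kahlerMetric (hω : IsKahlerForm ω) :
    ContDiffOn ℝ ((⊤ : ℕ∞) : WithTop ℕ∞) (kahlerMetric ω) (cstar n) := by
  refine contDiffOn_clm_apply.2 fun u => contDiffOn_clm_apply.2 fun v => ?_
  simp only [kahlerMetric_apply]
  exact hω.smooth_apply _

theorem fderiv_kahlerMetric (hω : IsKahlerForm ω) (hz : z ∈ cstar n) (u v w : Fin n → ℂ) :
    fderiv ℝ (kahlerMetric ω) z u v w = fderiv ℝ (fun y => ω y ![v, Complex.I • w]) z u := by
  have hd : DifferentiableAt ℝ (kahlerMetric ω) z :=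
    (hω.smooth_kahlerMetric.contDiffAt ((isOpen_cstar n).mem_nhds hz)).differentiableAt (by simp)
  simp only [← kahlerMetric_apply]
  rw [((hd.hasFDerivAt.clm_apply (hasFDerivAt_const v z)).clm_apply
    (hasFDerivAt_const w z)).fderiv]
  simp

theorem fderiv_cyclic (hω : IsKahlerForm ω) (hz : z ∈ cstar n) (u v w : Fin n → ℂ) :
    fderiv ℝ (fun y => ω y ![v, w]) z u + fderiv ℝ (fun y => ω y ![w, u]) z v
      + fderiv ℝ (fun y => ω y ![u, v]) z w = 0 := by
  have h := congrArg (fun η => η ![u, v, w]) (hω.closed z hz)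
  rw [extDeriv_apply (hω.differentiableAt hz)] at h
  have h0 : (0 : Fin 3).removeNth ![u, v, w] = ![v, w] := by
    ext i; fin_cases i <;> rfl
  have h1 : (1 : Fin 3).removeNth ![u, v, w] = ![u, w] := by
    ext i; fin_cases i <;> rfl
  have h2 : (2 : Fin 3).removeNth ![u, v, w] = ![u, v] := by
    ext i; fin_cases i <;> rfl
  have h3 : fderiv ℝ (fun y => ω y ![u, w]) z = -fderiv ℝ (fun y => ω y ![w, u]) z := by
    rw [← fderiv_fun_neg]
    congr 1
    ext y
    exact form_antisymm _ _ _
  simp [Fin.sum_univ_three, h0, h1, h2, h3] at h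
  linarith

theorem isKahlerOn (hω : IsKahlerForm ω) : IsKahlerOn (kahlerMetric ω) (mulI n) (cstar n) where
  isOpen := isOpen_cstar n
  smooth := hω.smooth_kahlerMetric
  symm z hz u v := by
    rw [kahlerMetric_apply, kahlerMetric_apply, form_antisymm, ← hω.compatible z hz v,
      smul_smul, Complex.I_mul_I, ← formToBilin_apply, ← formToBilin_apply]
    simp
  pos z hz v hv := by
    rw [kahlerMetric_apply]
    exact hω.positive z hz v hv
  sq u := by simp [mulI_apply, smul_smul]
  orthogonal z hz u v := by
    rw [kahlerMetric_apply, kahlerMetric_apply, mulI_apply, mulI_apply, hω.compatible z hz]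
  closed z hz u v w := by
    have h : ∀ a b c : Fin n → ℂ, fderiv ℝ (kahlerMetric ω) z a (mulI n b) c =
        fderiv ℝ (fun y => ω y ![b, c]) z a := by
      intro a b c
      rw [hω.fderiv_kahlerMetric hz, mulI_apply]
      congr 1
      apply Filter.EventuallyEq.fderiv_eq
      filter_upwards [(isOpen_cstar n).mem_nhds hz] with y hy using hω.compatible y hy b c
    rw [h, h, h]
    exact hω.fderiv_cyclic hz u v w

end IsKahlerForm

end ToricKahler

namespace ToricKahler

variable {n : ℕ}

/-! ### The Gram matrix of the fundamental vector fields -/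

/-- The fundamental vector field of the `i`-th basis vector of the Lie algebra of the torus. -/
noncomputable def basisField (i : Fin n) (z : Fin n → ℂ) : Fin n → ℂ := fundField (Pi.single i 1) z

theorem basisField_eq (i : Fin n) (z : Fin n → ℂ) :
    basisField i z = Pi.single i (Complex.I * z i) := by
  ext j
  by_cases h : j = i
  · subst h; simp [basisField, fundField]
  · simp [basisField, fundField, h]

theorem basisField_torusAct (i : Fin n) (t : Fin n → Circle) (z : Fin n → ℂ) :
    basisField i (torusAct t z) = torusAct t (basisField i z) := by
  ext j
  simp only [basisField, fundField, torusAct]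
  ring

theorem torusAct_mem {z : Fin n → ℂ} (hz : z ∈ cstar n) (t : Fin n → Circle) :
    torusAct t z ∈ cstar n := fun j => mul_ne_zero (Circle.coe_ne_zero _) (hz j)

/-- The Gram matrix of the fundamental vector fields. -/
noncomputable def gram (ω : (Fin n → ℂ) → (Fin n → ℂ) [⋀^Fin 2]→L[ℝ] ℝ) (z : Fin n → ℂ) :
    Matrix (Fin n) (Fin n) ℝ :=
  Matrix.of fun i j => kahlerMetric ω z (basisField i z) (basisField j z)

theorem gram_apply (ω : (Fin n → ℂ) → (Fin n → ℂ) [⋀^Fin 2]→L[ℝ] ℝ) (z : Fin n → ℂ)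
    (i j : Fin n) : gram ω z i j = kahlerMetric ω z (basisField i z) (basisField j z) := rfl

/-- The real linear map given by a torus element. -/
noncomputable def torusActCLM (t : Fin n → Circle) : (Fin n → ℂ) →L[ℝ] (Fin n → ℂ) :=
  ContinuousLinearMap.pi fun j =>
    ((t j : ℂ) • ContinuousLinearMap.id ℝ ℂ).comp (ContinuousLinearMap.proj j)

theorem torusActCLM_apply (t : Fin n → Circle) (z : Fin n → ℂ) :
    torusActCLM t z = torusAct t z := by
  ext j; simp [torusActCLM, torusAct]

variable {ω : (Fin n → ℂ) → (Fin n → ℂ) [⋀^Fin 2]→L[ℝ] ℝ} {z : Fin n → ℂ}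

/-! ### Consequences of the invariance of the moment map -/

namespace IsHamiltonian

/-- The orbits of the torus are isotropic. -/
theorem form_fundField (h : IsHamiltonian ω) (hz : z ∈ cstar n) (X Y : Fin n → ℝ) :
    ω z ![fundField X z, fundField Y z] = 0 := by
  obtain ⟨μ, hμ⟩ := h
  have hd : HasFDerivAt (fun y => μ y X) (fderiv ℝ (fun y => μ y X) z)
      (torusAct (torusExp ((0 : ℝ) • Y)) z) := by
    have : torusAct (torusExp ((0 : ℝ) • Y)) z = z := by
      ext j; simp [torusAct, torusExp]
    rw [this]
    exact ((hμ.differentiableAt z hz).clm_apply (differentiableAt_const X)).hasFDerivAt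
  have h1 := hd.comp_hasDerivAt (0 : ℝ) (hasDerivAt_fundField Y z)
  -- The moment map is constant along the orbit, so its derivative in the direction of the field of
  -- `Y` is zero.
  have h2 : (fun y => μ y X) ∘ (fun s : ℝ => torusAct (torusExp (s • Y)) z) =
      fun _ => μ z X := by
    funext s
    simp [hμ.equivariant _ z hz]
  rw [h2] at h1
  rw [← hμ.fderiv_eq X z hz]
  exact h1.unique (hasDerivAt_const _ _)

/-- Invariance of `ω` is not assumed. Differentiating the invariance of the moment map yields it
when one argument is a fundamental field, which is all the Gram matrix needs. -/
theorem form_torusAct (h : IsHamiltonian ω) (hz : z ∈ cstar n) (t : Fin n → Circle)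
    (X : Fin n → ℝ) (v : Fin n → ℂ) :
    ω (torusAct t z) ![fundField X (torusAct t z), torusAct t v] = ω z ![fundField X z, v] := by
  obtain ⟨μ, hμ⟩ := h
  have hd : HasFDerivAt (fun y => μ y X) (fderiv ℝ (fun y => μ y X) (torusAct t z))
      (torusActCLM t z) := by
    rw [torusActCLM_apply]
    exact ((hμ.differentiableAt _ (torusAct_mem hz t)).clm_apply
      (differentiableAt_const X)).hasFDerivAt
  have h1 := hd.comp z (torusActCLM t).hasFDerivAt
  have h2 : (fun y => μ y X) =ᶠ[nhds z] (fun y => μ y X) ∘ torusActCLM t := by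
    filter_upwards [(isOpen_cstar n).mem_nhds hz] with y hy
    simp [torusActCLM_apply, hμ.equivariant t y hy]
  have h3 := DFunLike.congr_fun (h1.congr_of_eventuallyEq h2).fderiv v
  rw [ContinuousLinearMap.comp_apply, torusActCLM_apply, hμ.fderiv_eq X _ (torusAct_mem hz t),
    hμ.fderiv_eq X z hz] at h3
  exact h3.symm

theorem gram_torusAct (h : IsHamiltonian ω) (hz : z ∈ cstar n) (t : Fin n → Circle) :
    gram ω (torusAct t z) = gram ω z := by
  ext i j
  rw [gram_apply, gram_apply, kahlerMetric_apply, kahlerMetric_apply]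
  refine Eq.trans ?_ (h.form_torusAct hz t (Pi.single i 1) (Complex.I • basisField j z))
  have : Complex.I • torusAct t (basisField j z) = torusAct t (Complex.I • basisField j z) := by
    ext k; simp [torusAct]; ring
  rw [basisField_torusAct j, this]
  rfl

/-- Isotropy of the orbits kills the imaginary part of each entry of the Hermitian matrix. -/
theorem detH_eq (h : IsHamiltonian ω) (hz : z ∈ cstar n) : detH ω z = ((gram ω z).det : ℂ) := by
  have hm : (Matrix.of fun i j : Fin n => kahlerHermitian ω z (fundField (Pi.single i 1) z)
      (fundField (Pi.single j 1) z)) = (gram ω z).map (Complex.ofRealHom) := by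
    ext i j
    simp [kahlerHermitian, h.form_fundField hz, gram_apply, basisField]
  rw [detH, hm, ← RingHom.mapMatrix_apply, ← RingHom.map_det]
  rfl

end IsHamiltonian

namespace IsKahlerForm

theorem gram_posDef (hω : IsKahlerForm ω) (hz : z ∈ cstar n) : (gram ω z).PosDef := by
  refine Matrix.PosDef.of_dotProduct_mulVec_pos ?_ fun c hc => ?_
  · ext i j
    simpa [gram_apply] using hω.isKahlerOn.symm z hz _ _
  · have h1 : star c ⬝ᵥ (gram ω z).mulVec c =
        kahlerMetric ω z (∑ i, c i • basisField i z) (∑ i, c i • basisField i z) := by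
      simp only [dotProduct, Matrix.mulVec, gram_apply, map_sum, map_smul, sum_apply, smul_apply,
        star_trivial, smul_eq_mul, Finset.mul_sum]
      rw [Finset.sum_comm]
      refine Finset.sum_congr rfl fun i _ => Finset.sum_congr rfl fun j _ => ?_
      ring
    rw [h1]
    refine hω.isKahlerOn.pos z hz _ fun h0 => hc ?_
    funext j
    have := congrFun h0 j
    simpa [basisField_eq, Finset.sum_apply, Pi.single_apply, hz j] using this

theorem gram_det_pos (hω : IsKahlerForm ω) (hz : z ∈ cstar n) : 0 < (gram ω z).det :=
  (hω.gram_posDef hz).det_pos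

end IsKahlerForm

/-! ### The volume of an orbit -/

theorem fderiv_torusExp (z : Fin n → ℂ) (θ v : Fin n → ℝ) :
    fderiv ℝ (fun θ : Fin n → ℝ => torusAct (torusExp θ) z) θ v =
      fundField v (torusAct (torusExp θ) z) := by
  have h : HasFDerivAt (fun θ : Fin n → ℝ => torusAct (torusExp θ) z)
      (ContinuousLinearMap.pi fun j => ((torusAct (torusExp θ) z j * Complex.I) •
        Complex.ofRealCLM).comp (ContinuousLinearMap.proj j)) θ := by
    rw [hasFDerivAt_pi]
    intro j
    have h1 : HasDerivAt (fun s : ℝ => (Circle.exp s : ℂ) * z j)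
        ((Circle.exp (θ j) : ℂ) * z j * Complex.I) (θ j) := by
      have := (((hasDerivAt_id (θ j)).ofReal_comp.mul_const Complex.I).cexp).mul_const (z j)
      convert! this using 1
      simp; ring
    have h2 := h1.hasFDerivAt.comp θ (ContinuousLinearMap.proj (R := ℝ) (φ := fun _ => ℝ) j).hasFDerivAt
    convert! h2 using 1
    ext v
    simp [torusAct, torusExp]
    ring
  rw [h.fderiv]
  ext j
  simp [fundField]
  ring

/-- The tangent vectors of the parametrization are the fundamental fields, so by invariance the
volume density is constant on the box of side `2π`. -/
theorem IsHamiltonian.orbitVolume_eq (h : IsHamiltonian ω) (hz : z ∈ cstar n) :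
    orbitVolume ω z = (2 * Real.pi) ^ n * Real.sqrt (gram ω z).det := by
  have h1 : ∀ θ : Fin n → ℝ, (Matrix.of fun i j : Fin n =>
      kahlerMetric ω (torusAct (torusExp θ) z)
        (fderiv ℝ (fun θ : Fin n → ℝ => torusAct (torusExp θ) z) θ (Pi.single i 1))
        (fderiv ℝ (fun θ : Fin n → ℝ => torusAct (torusExp θ) z) θ (Pi.single j 1))) =
      gram ω z := by
    intro θ
    rw [← h.gram_torusAct hz (torusExp θ)]
    ext i j
    simp [fderiv_torusExp, gram_apply, basisField]
  rw [orbitVolume, paramVolume]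
  simp only [h1]
  rw [MeasureTheory.setIntegral_const, smul_eq_mul, angleBox, MeasureTheory.measureReal_def,
    MeasureTheory.volume_pi_pi]
  simp [Real.pi_pos.le]

end ToricKahler

namespace ToricKahler

variable {n : ℕ}

/-! ### The derivative of the determinant of the Gram matrix -/

/-- Multiplication by a complex vector as a real linear map. -/
noncomputable def diagCLM (c : Fin n → ℂ) : (Fin n → ℂ) →L[ℝ] (Fin n → ℂ) :=
  ContinuousLinearMap.pi fun j =>
    (c j • ContinuousLinearMap.id ℝ ℂ).comp (ContinuousLinearMap.proj j)

theorem diagCLM_apply (c u : Fin n → ℂ) (j : Fin n) : diagCLM c u j = c j * u j := by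
  simp [diagCLM]

theorem map_complex_smul (A : (Fin n → ℂ) →L[ℝ] (Fin n → ℂ))
    (hA : ∀ u, A (mulI n u) = mulI n (A u)) (w : ℂ) (u : Fin n → ℂ) : A (w • u) = w • A u := by
  have h : ∀ x : Fin n → ℂ, w • x = w.re • x + w.im • mulI n x := by
    intro x
    ext j
    have := congrArg (· * x j) (Complex.re_add_im w)
    simp only [mulI_apply, Pi.smul_apply, Pi.add_apply, smul_eq_mul, Complex.real_smul] at this ⊢
    rw [← this]; ring
  rw [h, h, map_add, map_smul, map_smul, hA]

theorem hasDerivAt_line {E : Type*} [NormedAddCommGroup E] [NormedSpace ℝ E] (z v : E) (s : ℝ) :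
    HasDerivAt (fun s : ℝ => z + s • v) v s := by
  simpa using ((hasDerivAt_id s).smul_const v).const_add z

theorem hasDerivAt_comp_line {E F : Type*} [NormedAddCommGroup E] [NormedSpace ℝ E]
    [NormedAddCommGroup F] [NormedSpace ℝ F] {f : E → F} {z v : E} {s : ℝ}
    (h : DifferentiableAt ℝ f (z + s • v)) :
    HasDerivAt (fun s : ℝ => f (z + s • v)) (fderiv ℝ f (z + s • v) v) s :=
  h.hasFDerivAt.comp_hasDerivAt s (hasDerivAt_line z v s)

variable {ω : (Fin n → ℂ) → (Fin n → ℂ) [⋀^Fin 2]→L[ℝ] ℝ} {z : Fin n → ℂ}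

/-- The real part of the matrix of a complex linear map in the basis of fundamental fields. -/
noncomputable def fieldMatrix (A : (Fin n → ℂ) →L[ℝ] (Fin n → ℂ)) (z : Fin n → ℂ) :
    Matrix (Fin n) (Fin n) ℝ :=
  Matrix.of fun k i => (A (Pi.single i 1) k * z i / z k).re

theorem two_mul_trace_fieldMatrix (A : (Fin n → ℂ) →L[ℝ] (Fin n → ℂ))
    (hA : ∀ u, A (mulI n u) = mulI n (A u)) (hz : z ∈ cstar n) :
    2 * (fieldMatrix A z).trace = traceCLM (Fin n → ℂ) A := by
  rw [traceCLM_eq_of_complexLinear A hA, Matrix.trace]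
  congr 1
  refine Finset.sum_congr rfl fun k _ => ?_
  rw [Matrix.diag_apply, fieldMatrix, Matrix.of_apply, mul_div_assoc, div_self (hz k), mul_one]

/-- Expand `A X_i` in the complex frame `X_k`. The imaginary coefficients multiply `J X_k`, which is
orthogonal to every `X_j` because the orbits are isotropic, so only real parts contribute. -/
theorem metric_map_basisField (hω : IsKahlerForm ω) (h : IsHamiltonian ω) (hz : z ∈ cstar n)
    (A : (Fin n → ℂ) →L[ℝ] (Fin n → ℂ)) (hA : ∀ u, A (mulI n u) = mulI n (A u)) (i j : Fin n) :
    kahlerMetric ω z (A (basisField i z)) (basisField j z) =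
      ((fieldMatrix A z).transpose * gram ω z) i j := by
  have h1 : A (basisField i z) = ∑ k, ((fieldMatrix A z k i) • basisField k z
      + (A (Pi.single i 1) k * z i / z k).im • mulI n (basisField k z)) := by
    have h2 : basisField i z = (Complex.I * z i) • (Pi.single i 1 : Fin n → ℂ) := by
      rw [basisField_eq, ← Pi.single_smul]; simp
    rw [h2, map_complex_smul A hA]
    ext k
    have h3 : ∀ l, ((fieldMatrix A z l i) • basisField l z
      + (A (Pi.single i 1) l * z i / z l).im • mulI n (basisField l z)) k =
        if k = l then Complex.I * (A (Pi.single i 1) l * z i) else 0 := by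
      intro l
      by_cases hl : k = l
      · subst hl
        rw [if_pos rfl]
        change (A (Pi.single i 1) k * z i / z k).re • basisField k z k
          + (A (Pi.single i 1) k * z i / z k).im • mulI n (basisField k z) k = _
        rw [← div_mul_cancel₀ (A (Pi.single i 1) k * z i) (hz k), mul_div_assoc _ (z k) (z k),
          div_self (hz k), mul_one]
        simp only [basisField_eq, mulI_apply, Pi.smul_apply, Pi.single_eq_same, smul_eq_mul,
          Complex.real_smul]
        linear_combination (Complex.I * z k) * Complex.re_add_im (A (Pi.single i 1) k * z i / z k)
      · simp [basisField_eq, mulI_apply, hl]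
    rw [Finset.sum_apply, Finset.sum_congr rfl fun l _ => h3 l]
    simp
    ring
  have h5 : ∀ k, kahlerMetric ω z (mulI n (basisField k z)) (basisField j z) = 0 := by
    intro k
    rw [kahlerMetric_apply, mulI_apply, hω.compatible z hz]
    exact h.form_fundField hz _ _
  rw [h1, Matrix.mul_apply]
  simp [h5, gram_apply]

theorem hasDerivAt_gram_det (hω : IsKahlerForm ω) (h : IsHamiltonian ω) (hz : z ∈ cstar n)
    (v : Fin n → ℂ) :
    HasDerivAt (fun s : ℝ => (gram ω (z + s • v)).det) ((gram ω z).det *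
      (traceCLM (Fin n → ℂ) (christoffel (kahlerMetric ω) z v) + 2 * ∑ k, (v k / z k).re)) 0 := by
  have hK := hω.isKahlerOn
  -- On fundamental fields `A` is the covariant derivative along `v`: the field `X_i` is linear in
  -- `z`, and its ordinary derivative along `v` is `(v/z) X_i`.
  set A : (Fin n → ℂ) →L[ℝ] (Fin n → ℂ) :=
    christoffel (kahlerMetric ω) z v + diagCLM fun j => v j / z j with hAdef
  have hD : ∀ u, diagCLM (fun j => v j / z j) (mulI n u) =
      mulI n (diagCLM (fun j => v j / z j) u) := by
    intro u; ext j; simp [diagCLM_apply, mulI_apply]; ring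
  have hA : ∀ u, A (mulI n u) = mulI n (A u) := by
    intro u
    rw [hAdef, add_apply, add_apply, map_add, hK.christoffel_J_right hz, hD]
  have hfield : ∀ i, basisField i v = diagCLM (fun j => v j / z j) (basisField i z) := by
    intro i
    ext j
    rw [diagCLM_apply, basisField, basisField, fundField, fundField]
    field_simp [hz j]
  have hfieldD : ∀ i, HasDerivAt (fun s : ℝ => basisField i (z + s • v)) (basisField i v) 0 := by
    intro i
    have : ∀ s : ℝ, basisField i (z + s • v) = basisField i z + s • basisField i v := by
      intro s; ext j; simp [basisField, fundField]; ring
    simp only [this]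
    exact hasDerivAt_line _ _ _
  have hg : HasDerivAt (fun s : ℝ => kahlerMetric ω (z + s • v)) (fderiv ℝ (kahlerMetric ω) z v)
      0 := by
    have := hasDerivAt_comp_line (f := kahlerMetric ω) (z := z) (v := v) (s := 0)
      (by simpa using hK.differentiableAt hz)
    simpa using this
  -- Metric compatibility gives the derivative `Fᵀ G + G F` of the Gram matrix `G`, where `F` is the
  -- field matrix of `A`.
  have hM := hasDerivAt_det (M := fun s => gram ω (z + s • v))
    (M' := (fieldMatrix A z).transpose * gram ω z + gram ω z * fieldMatrix A z) (s := 0)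
    (fun i j => by
      have h1 := (hg.clm_apply (hfieldD i)).clm_apply (hfieldD j)
      refine h1.congr_deriv ?_
      have h2 : (gram ω z * fieldMatrix A z) i j =
          ((fieldMatrix A z).transpose * gram ω z) j i := by
        have hs : (gram ω z).transpose = gram ω z := by
          ext i j; exact hK.symm z hz _ _
        rw [← Matrix.transpose_apply ((fieldMatrix A z).transpose * _), Matrix.transpose_mul, hs,
          Matrix.transpose_transpose]
      rw [Matrix.add_apply, h2, ← metric_map_basisField hω h hz A hA,
        ← metric_map_basisField hω h hz A hA]
      simp only [zero_smul, add_zero, hfield, hAdef, add_apply, map_add]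
      rw [hK.fderiv_eq_christoffel hz, hK.symm z hz (basisField i z),
        hK.symm z hz (basisField i z) (diagCLM _ _)]
      ring)
  refine hM.congr_deriv ?_
  simp only [zero_smul, add_zero]
  have ht : traceCLM (Fin n → ℂ) (diagCLM fun j => v j / z j) = 2 * ∑ k, (v k / z k).re := by
    rw [traceCLM_eq_of_complexLinear _ hD]
    simp [diagCLM_apply]
  -- Cyclicity of the trace and `adj(G) G = det G` reduce Jacobi's formula to `2 det G tr F = det G
  -- tr A`.
  rw [← ht, ← map_add, ← hAdef, ← two_mul_trace_fieldMatrix A hA hz, mul_add, Matrix.trace_add,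
    ← mul_assoc, ← mul_assoc, Matrix.adjugate_mul, Matrix.trace_mul_cycle, Matrix.mul_adjugate]
  simp
  ring

end ToricKahler

namespace ToricKahler

variable {n : ℕ}

/-! ### The Ricci tensor in logarithmic coordinates -/

/-- The logarithms of the absolute values of the coordinates. -/
noncomputable def logNorm (z : Fin n → ℂ) : Fin n → ℝ := fun j => Real.log ‖z j‖

/-- The real parts of the coordinatewise quotients of `v` by `z`. -/
noncomputable def ratioRe (z v : Fin n → ℂ) : Fin n → ℝ := fun j => (v j / z j).re

theorem expPoint_mem (x : Fin n → ℝ) : expPoint x ∈ cstar n := fun _ => Complex.exp_ne_zero _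

theorem logNorm_expPoint (x : Fin n → ℝ) : logNorm (expPoint x) = x := by
  ext j
  simp [logNorm, expPoint, Complex.norm_exp]

theorem logNorm_torusAct (t : Fin n → Circle) (z : Fin n → ℂ) :
    logNorm (torusAct t z) = logNorm z := by
  ext j
  simp only [logNorm, torusAct, norm_mul, Circle.norm_coe, one_mul]

theorem exists_torusAct_expPoint {z : Fin n → ℂ} (hz : z ∈ cstar n) :
    ∃ t : Fin n → Circle, torusAct t (expPoint (logNorm z)) = z := by
  obtain ⟨x, ⟨t, ht⟩, -⟩ := existsUnique_expPoint z hz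
  have hx : logNorm z = x := by rw [← ht, logNorm_torusAct, logNorm_expPoint]
  exact ⟨t, by rw [hx, ht]⟩

theorem hasDerivAt_log_norm {w : ℝ → ℂ} {w' : ℂ} {s : ℝ} (hw : HasDerivAt w w' s)
    (h0 : w s ≠ 0) : HasDerivAt (fun t => Real.log ‖w t‖) (w' / w s).re s := by
  have h1 : (fun t => Real.log ‖w t‖) = fun t => 1 / 2 * Real.log (‖w t‖ ^ 2) := by
    funext t
    rw [Real.log_pow]
    push_cast
    ring
  have hsq : ‖w s‖ ^ 2 ≠ 0 := pow_ne_zero _ (norm_ne_zero_iff.2 h0)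
  rw [h1]
  refine ((hw.norm_sq.log hsq).const_mul (1 / 2)).congr_deriv ?_
  rw [Complex.inner, Complex.div_re, ← Complex.sq_norm]
  simp
  field_simp

theorem hasDerivAt_logNorm {z v : Fin n → ℂ} {s : ℝ} (hz : z + s • v ∈ cstar n) :
    HasDerivAt (fun s : ℝ => logNorm (z + s • v)) (ratioRe (z + s • v) v) s :=
  hasDerivAt_pi.2 fun j => hasDerivAt_log_norm (hasDerivAt_pi.1 (hasDerivAt_line z v s) j) (hz j)

theorem hasDerivAt_ratioRe {z v : Fin n → ℂ} (hz : z ∈ cstar n) :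
    HasDerivAt (fun s : ℝ => ratioRe (z + s • v) v) (fun j => (-(v j / z j) ^ 2).re) 0 := by
  refine hasDerivAt_pi.2 fun j => ?_
  have h1 : HasDerivAt (fun s : ℝ => (z + s • v) j) (v j) 0 :=
    hasDerivAt_pi.1 (hasDerivAt_line z v 0) j
  have h2 := (h1.inv (by simpa using hz j)).const_mul (v j)
  have h3 := Complex.reCLM.hasFDerivAt.comp_hasDerivAt (0 : ℝ) h2
  refine h3.congr_deriv ?_
  simp only [Complex.reCLM_apply, zero_smul, add_zero]
  congr 1
  have := hz j
  field_simp

/-- The function `log H` on the orbit space. -/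
noncomputable def logDet (ω : (Fin n → ℂ) → (Fin n → ℂ) [⋀^Fin 2]→L[ℝ] ℝ) (x : Fin n → ℝ) : ℝ :=
  Real.log (gram ω (expPoint x)).det

variable {ω : (Fin n → ℂ) → (Fin n → ℂ) [⋀^Fin 2]→L[ℝ] ℝ} {z : Fin n → ℂ}

theorem log_det_gram (h : IsHamiltonian ω) (hz : z ∈ cstar n) :
    Real.log (gram ω z).det = logDet ω (logNorm z) := by
  obtain ⟨t, ht⟩ := exists_torusAct_expPoint hz
  conv_lhs => rw [← ht, h.gram_torusAct (expPoint_mem _)]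
  rfl

theorem contDiff_expPoint : ContDiff ℝ ((⊤ : ℕ∞) : WithTop ℕ∞) (expPoint (n := n)) := by
  refine contDiff_pi.2 fun j => ?_
  exact (Complex.ofRealCLM.contDiff.comp (contDiff_apply ℝ ℝ j)).cexp

theorem contDiff_basisField (i : Fin n) :
    ContDiff ℝ ((⊤ : ℕ∞) : WithTop ℕ∞) (basisField i) := by
  refine contDiff_pi.2 fun j => ?_
  exact contDiff_const.mul (contDiff_apply ℝ ℂ j)

theorem IsKahlerForm.contDiff_logDet (hω : IsKahlerForm ω) :
    ContDiff ℝ ((⊤ : ℕ∞) : WithTop ℕ∞) (logDet ω) := by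
  have h1 : ∀ i j, ContDiff ℝ ((⊤ : ℕ∞) : WithTop ℕ∞) fun x => gram ω (expPoint x) i j := by
    intro i j
    have h0 : ContDiff ℝ ((⊤ : ℕ∞) : WithTop ℕ∞) fun x => kahlerMetric ω (expPoint x) :=
      hω.smooth_kahlerMetric.comp_contDiff contDiff_expPoint expPoint_mem
    exact (h0.clm_apply ((contDiff_basisField i).comp contDiff_expPoint)).clm_apply
      ((contDiff_basisField j).comp contDiff_expPoint)
  have h2 : ContDiff ℝ ((⊤ : ℕ∞) : WithTop ℕ∞) fun x => (gram ω (expPoint x)).det := by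
    simp only [Matrix.det_apply]
    exact ContDiff.sum fun σ _ => (contDiff_prod fun i _ => h1 _ _).const_smul _
  exact h2.log fun x => (hω.gram_det_pos (expPoint_mem x)).ne'

/-- The derivative of `log H` along `v` is computed in two ways: by Jacobi's formula, and by the
chain rule through the logarithmic coordinates. -/
theorem traceCLM_christoffel (hω : IsKahlerForm ω) (h : IsHamiltonian ω) (hz : z ∈ cstar n)
    (v : Fin n → ℂ) :
    traceCLM (Fin n → ℂ) (christoffel (kahlerMetric ω) z v) =
      fderiv ℝ (logDet ω) (logNorm z) (ratioRe z v) - 2 * ∑ k, ratioRe z v k := by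
  have hz0 : z + (0 : ℝ) • v ∈ cstar n := by simpa using hz
  have hpos := hω.gram_det_pos hz
  have h1 := (hasDerivAt_gram_det hω h hz v).log (by simpa using hpos.ne')
  have h2 := ((hω.contDiff_logDet.differentiable (by simp)).differentiableAt.hasFDerivAt
    (x := logNorm (z + (0 : ℝ) • v))).comp_hasDerivAt (0 : ℝ) (hasDerivAt_logNorm hz0)
  have hev : ∀ᶠ s : ℝ in nhds 0, z + s • v ∈ cstar n :=
    (hasDerivAt_line z v 0).continuousAt.eventually ((isOpen_cstar n).mem_nhds hz0)
  have h3 : (fun s : ℝ => Real.log (gram ω (z + s • v)).det) =ᶠ[nhds 0]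
      logDet ω ∘ fun s : ℝ => logNorm (z + s • v) := by
    filter_upwards [hev] with s hs using log_det_gram h hs
  have h4 := h1.unique (h2.congr_of_eventuallyEq h3)
  simp only [zero_smul, add_zero] at h4
  rw [mul_comm, mul_div_assoc, div_self hpos.ne', mul_one] at h4
  rw [← h4]
  simp only [ratioRe]
  ring

/-- The formula for `tr Γ(v)` is differentiated along the line `z + s v`. The terms in parentheses
come from the derivative `-(v/z)²` of `v/z`. -/
theorem traceCLM_fderiv_christoffel (hω : IsKahlerForm ω) (h : IsHamiltonian ω) (hz : z ∈ cstar n)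
    (v : Fin n → ℂ) :
    traceCLM (Fin n → ℂ) (fderiv ℝ (christoffel (kahlerMetric ω)) z v v) =
      fderiv ℝ (fderiv ℝ (logDet ω)) (logNorm z) (ratioRe z v) (ratioRe z v)
      + (fderiv ℝ (logDet ω) (logNorm z) (fun j => (-(v j / z j) ^ 2).re)
        - 2 * ∑ k, (-(v k / z k) ^ 2).re) := by
  have hz0 : z + (0 : ℝ) • v ∈ cstar n := by simpa using hz
  have h1 := (traceCLM (Fin n → ℂ)).hasFDerivAt.comp_hasDerivAt (0 : ℝ)
    ((hasDerivAt_comp_line (hω.isKahlerOn.differentiableAt_christoffel hz0)).clm_apply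
      (hasDerivAt_const (0 : ℝ) v))
  have hd : Differentiable ℝ (fderiv ℝ (logDet ω)) :=
    (hω.contDiff_logDet.fderiv_right (m := 1) (WithTop.coe_le_coe.2 le_top)).differentiable
      (by simp)
  have h2 := (((hd _).hasFDerivAt.comp_hasDerivAt (0 : ℝ) (hasDerivAt_logNorm hz0)).clm_apply
    (hasDerivAt_ratioRe (v := v) hz)).sub ((HasDerivAt.fun_sum fun k (_ : k ∈ Finset.univ) =>
      hasDerivAt_pi.1 (hasDerivAt_ratioRe (v := v) hz) k).const_mul 2)
  have hev : ∀ᶠ s : ℝ in nhds 0, z + s • v ∈ cstar n :=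
    (hasDerivAt_line z v 0).continuousAt.eventually ((isOpen_cstar n).mem_nhds hz0)
  have h4 := h1.unique (h2.congr_of_eventuallyEq (by
    filter_upwards [hev] with s hs using traceCLM_christoffel hω h hs v))
  simp only [Function.comp_apply, zero_smul, add_zero, map_zero] at h4
  rw [h4, add_sub_assoc]

/-- The Ricci tensor in terms of the Hessian of `log H` on the orbit space. -/
theorem ricci_eq_hessian (hω : IsKahlerForm ω) (h : IsHamiltonian ω) (hz : z ∈ cstar n)
    (v : Fin n → ℂ) :
    ricci (kahlerMetric ω) z v v = -(1 / 2) *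
      (fderiv ℝ (fderiv ℝ (logDet ω)) (logNorm z) (ratioRe z v) (ratioRe z v)
      + fderiv ℝ (fderiv ℝ (logDet ω)) (logNorm z) (ratioRe z (mulI n v))
        (ratioRe z (mulI n v))) := by
  rw [hω.isKahlerOn.ricci_eq hz, traceCLM_fderiv_christoffel hω h hz,
    traceCLM_fderiv_christoffel hω h hz]
  -- Replacing `v` by `iv` changes the sign of `(v/z)²`, so all terms without a Hessian cancel in
  -- the sum.
  have h1 : (fun j => (-(mulI n v j / z j) ^ 2).re) = -fun j => (-(v j / z j) ^ 2).re := by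
    ext j
    have : -(mulI n v j / z j) ^ 2 = (v j / z j) ^ 2 := by
      simp only [mulI_apply, Pi.smul_apply, smul_eq_mul, div_pow, mul_pow, Complex.I_sq]
      ring
    rw [this, Pi.neg_apply, Complex.neg_re, neg_neg]
  have h2 : ∑ k, (-(mulI n v k / z k) ^ 2).re = -∑ k, (-(v k / z k) ^ 2).re := by
    rw [← Finset.sum_neg_distrib]
    exact Finset.sum_congr rfl fun k _ => congrFun h1 k
  rw [h2, h1, map_neg]
  ring

end ToricKahler

namespace ToricKahler

/-! ### Convexity and the Hessian -/

section Hessian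

variable {E : Type*} [NormedAddCommGroup E] [NormedSpace ℝ E] {f : E → ℝ}

theorem deriv_comp_line (hf : ContDiff ℝ 2 f) (x v : E) :
    deriv (fun s : ℝ => f (x + s • v)) = fun s => fderiv ℝ f (x + s • v) v :=
  funext fun _ => (hasDerivAt_comp_line (hf.differentiable (by simp) _)).deriv

theorem hasDerivAt_fderiv_comp_line (hf : ContDiff ℝ 2 f) (x v : E) (s : ℝ) :
    HasDerivAt (fun s : ℝ => fderiv ℝ f (x + s • v) v)
      (fderiv ℝ (fderiv ℝ f) (x + s • v) v v) s := by
  have hd : Differentiable ℝ (fderiv ℝ f) :=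
    (hf.fderiv_right (m := 1) (by norm_num)).differentiable (by simp)
  simpa using (hasDerivAt_comp_line (hd (x + s • v))).clm_apply (hasDerivAt_const s v)

/-- Convexity is tested on lines, where the second derivative is the Hessian on the direction
vector. -/
theorem convexOn_univ_iff_hessian_nonneg (hf : ContDiff ℝ 2 f) :
    ConvexOn ℝ Set.univ f ↔ ∀ x v, 0 ≤ fderiv ℝ (fderiv ℝ f) x v v := by
  have hdiff : ∀ x v : E, Differentiable ℝ fun s : ℝ => f (x + s • v) := fun x v s =>
    (hasDerivAt_comp_line (hf.differentiable (by simp) _)).differentiableAt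
  constructor
  · intro h x v
    have hc : ConvexOn ℝ Set.univ fun s : ℝ => f (x + s • v) := by
      refine ⟨convex_univ, fun s _ t _ a b ha hb hab => ?_⟩
      have h1 := h.2 (Set.mem_univ (x + s • v)) (Set.mem_univ (x + t • v)) ha hb hab
      have h2 : a • (x + s • v) + b • (x + t • v) = x + (a • s + b • t) • v := by
        have hx : x = (a + b) • x := by rw [hab, one_smul]
        nth_rewrite 3 [hx]
        simp only [smul_eq_mul]
        module
      rwa [h2] at h1
    have hm := hc.monotoneOn_deriv fun s _ => hdiff x v s
    rw [deriv_comp_line hf, monotoneOn_univ] at hm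
    have h3 := Monotone.deriv_nonneg hm (x := 0)
    rw [(hasDerivAt_fderiv_comp_line hf x v 0).deriv] at h3
    simpa using h3
  · intro h
    refine ⟨convex_univ, fun x _ y _ a b ha hb hab => ?_⟩
    have hc : ConvexOn ℝ Set.univ fun s : ℝ => f (x + s • (y - x)) := by
      refine convexOn_univ_of_deriv2_nonneg (hdiff _ _) ?_ fun s => ?_
      · rw [deriv_comp_line hf]
        exact fun s => (hasDerivAt_fderiv_comp_line hf x _ s).differentiableAt
      · rw [Function.iterate_succ, Function.iterate_one, Function.comp_apply, deriv_comp_line hf,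
          (hasDerivAt_fderiv_comp_line hf x _ s).deriv]
        exact h _ _
    have h1 := hc.2 (Set.mem_univ 0) (Set.mem_univ 1) ha hb hab
    have h2 : x + (a • (0 : ℝ) + b • (1 : ℝ)) • (y - x) = a • x + b • y := by
      rw [eq_sub_of_add_eq hab]
      simp only [smul_eq_mul]
      module
    beta_reduce at h1
    rw [h2] at h1
    simpa using h1

theorem concaveOn_univ_iff_hessian_nonpos (hf : ContDiff ℝ 2 f) :
    ConcaveOn ℝ Set.univ f ↔ ∀ x v, fderiv ℝ (fderiv ℝ f) x v v ≤ 0 := by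
  rw [← neg_convexOn_iff, convexOn_univ_iff_hessian_nonneg (f := -f) hf.neg]
  have h1 : fderiv ℝ (-f) = -fderiv ℝ f := funext fun x => fderiv_neg
  simp [h1, fderiv_neg]

theorem eq_add_fderiv_of_hessian_eq_zero (hf : ContDiff ℝ 2 f)
    (h : ∀ x v, fderiv ℝ (fderiv ℝ f) x v v = 0) (x v : E) (s : ℝ) :
    f (x + s • v) = f x + fderiv ℝ f x v * s := by
  have h1 : ∀ s : ℝ, fderiv ℝ f (x + s • v) v = fderiv ℝ f x v := by
    intro s
    have := is_const_of_deriv_eq_zero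
      (fun s => (hasDerivAt_fderiv_comp_line hf x v s).differentiableAt)
      (fun s => by rw [(hasDerivAt_fderiv_comp_line hf x v s).deriv, h]) s 0
    simpa using this
  have h2 : ∀ s : ℝ, HasDerivAt (fun s : ℝ => f (x + s • v) - fderiv ℝ f x v * s) 0 s := by
    intro s
    have := (hasDerivAt_comp_line (z := x) (v := v) (s := s) (hf.differentiable (by simp) _)).sub
      ((hasDerivAt_id s).const_mul (fderiv ℝ f x v))
    refine this.congr_deriv ?_
    simp [h1]
  have h3 := is_const_of_deriv_eq_zero (fun s => (h2 s).differentiableAt)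
    (fun s => (h2 s).deriv) s 0
  simp only [zero_smul, add_zero, mul_zero, sub_zero] at h3
  linarith

end Hessian

/-! ### The volume functional -/

variable {n : ℕ} {ω : (Fin n → ℂ) → (Fin n → ℂ) [⋀^Fin 2]→L[ℝ] ℝ}

theorem vol_pos (hω : IsKahlerForm ω) (h : IsHamiltonian ω) (x : Fin n → ℝ) : 0 < vol ω x := by
  rw [vol, h.orbitVolume_eq (expPoint_mem x)]
  have := hω.gram_det_pos (expPoint_mem x)
  have := Real.pi_pos
  positivity

theorem log_vol (hω : IsKahlerForm ω) (h : IsHamiltonian ω) :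
    (fun x => Real.log (vol ω x)) =
      fun x => Real.log ((2 * Real.pi) ^ n) + 1 / 2 * logDet ω x := by
  funext x
  have h1 := hω.gram_det_pos (expPoint_mem x)
  have h2 := Real.pi_pos
  rw [vol, h.orbitVolume_eq (expPoint_mem x), Real.log_mul (by positivity)
    (Real.sqrt_pos.2 h1).ne', Real.log_sqrt h1.le, logDet]
  ring

theorem contDiff_log_vol (hω : IsKahlerForm ω) (h : IsHamiltonian ω) :
    ContDiff ℝ 2 fun x => Real.log (vol ω x) := by
  rw [log_vol hω h]
  exact contDiff_const.add (contDiff_const.mul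
    (hω.contDiff_logDet.of_le (WithTop.coe_le_coe.2 le_top)))

theorem hessian_log_vol (hω : IsKahlerForm ω) (h : IsHamiltonian ω) (x v w : Fin n → ℝ) :
    fderiv ℝ (fderiv ℝ fun x => Real.log (vol ω x)) x v w =
      1 / 2 * fderiv ℝ (fderiv ℝ (logDet ω)) x v w := by
  have hd : Differentiable ℝ (logDet ω) := hω.contDiff_logDet.differentiable (by simp)
  have hd2 : Differentiable ℝ (fderiv ℝ (logDet ω)) :=
    (hω.contDiff_logDet.fderiv_right (m := 1) (WithTop.coe_le_coe.2 le_top)).differentiable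
      (by simp)
  have h1 : (fderiv ℝ fun x => Real.log (vol ω x)) = fun x => (1 / 2 : ℝ) • fderiv ℝ (logDet ω) x := by
    rw [log_vol hω h]
    funext x
    rw [fderiv_const_add, fderiv_const_mul (hd x)]
  rw [h1, fderiv_fun_const_smul (hd2 x)]
  rfl

/-- The Ricci tensor in terms of the Hessian of the logarithm of the volume functional. -/
theorem ricci_eq_hessian_log_vol (hω : IsKahlerForm ω) (h : IsHamiltonian ω) {z : Fin n → ℂ}
    (hz : z ∈ cstar n) (v : Fin n → ℂ) :
    ricci (kahlerMetric ω) z v v =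
      -(fderiv ℝ (fderiv ℝ fun x => Real.log (vol ω x)) (logNorm z) (ratioRe z v) (ratioRe z v)
      + fderiv ℝ (fderiv ℝ fun x => Real.log (vol ω x)) (logNorm z) (ratioRe z (mulI n v))
        (ratioRe z (mulI n v))) := by
  rw [ricci_eq_hessian hω h hz, hessian_log_vol hω h, hessian_log_vol hω h]
  ring

/-- For this radial vector `v`, the vector `iv` is tangent to the orbit and does not change `log
|z|`, so a single Hessian value is isolated. This recovers the Hessian from the Ricci form. -/
theorem ricci_expPoint (hω : IsKahlerForm ω) (h : IsHamiltonian ω) (x a : Fin n → ℝ) :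
    ricci (kahlerMetric ω) (expPoint x) (fun j => a j * expPoint x j)
      (fun j => a j * expPoint x j) =
      -fderiv ℝ (fderiv ℝ fun x => Real.log (vol ω x)) x a a := by
  have h1 : ratioRe (expPoint x) (fun j => a j * expPoint x j) = a := by
    ext j
    rw [ratioRe, mul_div_assoc, div_self (expPoint_mem x j), mul_one, Complex.ofReal_re]
  have h2 : ratioRe (expPoint x) (mulI n fun j => a j * expPoint x j) = 0 := by
    ext j
    rw [ratioRe, mulI_apply, Pi.smul_apply, smul_eq_mul, ← mul_assoc, mul_div_assoc,
      div_self (expPoint_mem x j)]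
    simp
  rw [ricci_eq_hessian_log_vol hω h (expPoint_mem x), h1, h2, logNorm_expPoint]
  simp

theorem ricci_nonpos_iff (hω : IsKahlerForm ω) (h : IsHamiltonian ω) :
    (∀ z ∈ cstar n, ∀ v, ricci (kahlerMetric ω) z v v ≤ 0) ↔
      ConvexOn ℝ Set.univ fun x => Real.log (vol ω x) := by
  rw [convexOn_univ_iff_hessian_nonneg (contDiff_log_vol hω h)]
  constructor
  · intro hR x a
    have := hR _ (expPoint_mem x) (fun j => a j * expPoint x j)
    rw [ricci_expPoint hω h] at this
    linarith
  · intro hH z hz v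
    rw [ricci_eq_hessian_log_vol hω h hz]
    linarith [hH (logNorm z) (ratioRe z v), hH (logNorm z) (ratioRe z (mulI n v))]

theorem ricci_nonneg_iff (hω : IsKahlerForm ω) (h : IsHamiltonian ω) :
    (∀ z ∈ cstar n, ∀ v, 0 ≤ ricci (kahlerMetric ω) z v v) ↔
      ConcaveOn ℝ Set.univ fun x => Real.log (vol ω x) := by
  rw [concaveOn_univ_iff_hessian_nonpos (contDiff_log_vol hω h)]
  constructor
  · intro hR x a
    have := hR _ (expPoint_mem x) (fun j => a j * expPoint x j)
    rw [ricci_expPoint hω h] at this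
    linarith
  · intro hH z hz v
    rw [ricci_eq_hessian_log_vol hω h hz]
    linarith [hH (logNorm z) (ratioRe z v), hH (logNorm z) (ratioRe z (mulI n v))]

theorem convexOn_exp_comp {E : Type*} [AddCommGroup E] [Module ℝ E] {f : E → ℝ}
    (hf : ConvexOn ℝ Set.univ f) : ConvexOn ℝ Set.univ fun x => Real.exp (f x) :=
  ⟨convex_univ, fun _ hx _ hy _ _ ha hb hab => (Real.exp_le_exp.2 (hf.2 hx hy ha hb hab)).trans
    (convexOn_exp.2 trivial trivial ha hb hab)⟩

end ToricKahler

/-! ### Sign of the Ricci curvature and convexity of the orbit volume -/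

theorem mainTheorem6 (n : ℕ) (ω : (Fin n → ℂ) → (Fin n → ℂ) [⋀^Fin 2]→L[ℝ] ℝ)
    (hω : ToricKahler.IsKahlerForm ω) (hHam : ToricKahler.IsHamiltonian ω) :
    -- `H` is invariant under the torus
    (∀ t : Fin n → Circle, ∀ z ∈ ToricKahler.cstar n,
      ToricKahler.detH ω (ToricKahler.torusAct t z) = ToricKahler.detH ω z) ∧
    -- the volume is a positive function on the orbit space
    (∀ t : Fin n → Circle, ∀ z ∈ ToricKahler.cstar n,
      ToricKahler.orbitVolume ω (ToricKahler.torusAct t z) = ToricKahler.orbitVolume ω z) ∧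
    (∀ x : Fin n → ℝ, 0 < ToricKahler.vol ω x) ∧
    -- nonpositive Ricci curvature
    ((∀ z ∈ ToricKahler.cstar n, ∀ v : Fin n → ℂ,
        ToricKahler.ricci (ToricKahler.kahlerMetric ω) z v v ≤ 0) ↔
      ConvexOn ℝ Set.univ fun x => Real.log (ToricKahler.vol ω x)) ∧
    ((∀ z ∈ ToricKahler.cstar n, ∀ v : Fin n → ℂ,
        ToricKahler.ricci (ToricKahler.kahlerMetric ω) z v v ≤ 0) →
      ConvexOn ℝ Set.univ (ToricKahler.vol ω)) ∧
    -- nonnegative Ricci curvature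
    ((∀ z ∈ ToricKahler.cstar n, ∀ v : Fin n → ℂ,
        0 ≤ ToricKahler.ricci (ToricKahler.kahlerMetric ω) z v v) ↔
      ConcaveOn ℝ Set.univ fun x => Real.log (ToricKahler.vol ω x)) ∧
    ((∀ z ∈ ToricKahler.cstar n, ∀ v : Fin n → ℂ,
        0 ≤ ToricKahler.ricci (ToricKahler.kahlerMetric ω) z v v) →
      ConvexOn ℝ Set.univ fun x => 1 / ToricKahler.vol ω x) ∧
    -- zero Ricci curvature
    ((∀ z ∈ ToricKahler.cstar n, ∀ v w : Fin n → ℂ,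
        ToricKahler.ricci (ToricKahler.kahlerMetric ω) z v w = 0) →
      (∃ A : (Fin n → ℝ) →ᵃ[ℝ] ℝ, ∀ x, Real.log (ToricKahler.vol ω x) = A x) ∧
      ∀ x v : Fin n → ℝ, ∃ a : ℝ, ∀ s : ℝ,
        Real.log (ToricKahler.vol ω (x + s • v)) = Real.log (ToricKahler.vol ω x) + a * s ∧
        ToricKahler.vol ω (x + s • v) = ToricKahler.vol ω x * Real.exp (a * s)) := by

  have hexp : ∀ x, Real.exp (Real.log (ToricKahler.vol ω x)) = ToricKahler.vol ω x := fun x =>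
    Real.exp_log (ToricKahler.vol_pos hω hHam x)
  have hconv := ToricKahler.ricci_nonpos_iff hω hHam
  have hconc := ToricKahler.ricci_nonneg_iff hω hHam
  refine ⟨fun t z hz => ?_, fun t z hz => ?_, ToricKahler.vol_pos hω hHam, hconv, fun hR => ?_,
    hconc, fun hR => ?_, fun hR => ?_⟩
  · rw [hHam.detH_eq hz, hHam.detH_eq (ToricKahler.torusAct_mem hz t), hHam.gram_torusAct hz]
  · rw [hHam.orbitVolume_eq hz, hHam.orbitVolume_eq (ToricKahler.torusAct_mem hz t),
      hHam.gram_torusAct hz]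
  · simpa only [hexp] using ToricKahler.convexOn_exp_comp (hconv.1 hR)
  -- Here `1 / Vol` is the exponential of the convex function `-log Vol`.
  · have := ToricKahler.convexOn_exp_comp (hconc.1 hR).neg
    simpa only [Pi.neg_apply, Real.exp_neg, hexp, one_div] using this
  · have hlin := ToricKahler.eq_add_fderiv_of_hessian_eq_zero
      (ToricKahler.contDiff_log_vol hω hHam) fun x a => by
        have := hR _ (ToricKahler.expPoint_mem x) (fun j => a j * ToricKahler.expPoint x j)
          (fun j => a j * ToricKahler.expPoint x j)
        rw [ToricKahler.ricci_expPoint hω hHam] at this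
        linarith
    -- The affine function is the first-order expansion at `0`; it is exact because `hlin` holds on
    -- the line from `0` to `x` at time `1`.
    refine ⟨⟨(fderiv ℝ (fun x => Real.log (ToricKahler.vol ω x)) 0).toLinearMap.toAffineMap
      + AffineMap.const ℝ _ (Real.log (ToricKahler.vol ω 0)), fun x => ?_⟩, fun x v =>
      ⟨fderiv ℝ (fun x => Real.log (ToricKahler.vol ω x)) x v, fun s => ⟨hlin x v s, ?_⟩⟩⟩
    · have := hlin 0 x 1
      simp only [zero_add, one_smul, mul_one] at this
      rw [this, add_comm]
      rfl
    · rw [← hexp, hlin x v s, Real.exp_add, hexp]
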